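/- Let $n$ be a positive integer. For $x,y\in\mathbb{R}^{n+1}$ write $x\cdot y=\sum_{i=0}^n x_iy_i$ and let $\langle x,y\rangle=-x_0y_0+x_1y_1+\cdots+x_ny_n$ be the Lorentzian inner product; $\mathbb{R}^{1,n}$ denotes $\mathbb{R}^{n+1}$ with $\langle\cdot,\cdot\rangle$. A non-zero vector $x$ is *time-like* if $\langle x,x\rangle<0$ and *space-like* if $\langle x,x\rangle>0$. A vector subspace of $\mathbb{R}^{1,n}$ is *time-like* if it contains a time-like vector, and *space-like* if all its non-zero vectors are space-like. For $k\ge 1$ and points $p_0,\dots,p_k\in\mathbb{R}^{n+1}$ define mappings $\mathbb{R}^{n+1}\to\mathbb{R}^{k+1}$ by $$L_{(p_0,\dots,p_k)}(x)=\bigl(\langle x-p_0,x-p_0\rangle,\dots,\langle x-p_k,x-p_k\rangle\bigr),$$ $$D_{(p_0,\dots,p_k)}(x)=\bigl((x-p_0)\cdot(x-p_0),\dots,(x-p_k)\cdot(x-p_k)\bigr)$$ (the Lorentzian distance-squared mapping and the distance-squared mapping). The *recognition subspace* is $V(p_0,\dots,p_k)=\sum_{i=1}^k\mathbb{R}\,(p_i-p_0)$,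 and $p_0,\dots,p_k$ are *in general position* if $\dim V(p_0,\dots,p_k)=k$. Two mappings $f,g:\mathbb{R}^{n+1}\to\mathbb{R}^{k+1}$ are *$\mathcal{A}$-equivalent* if $g=H\circ f\circ h$ for some $C^\infty$ diffeomorphisms $h:\mathbb{R}^{n+1}\to\mathbb{R}^{n+1}$ and $H:\mathbb{R}^{k+1}\to\mathbb{R}^{k+1}$. Then the following hold. 1. Let $k,n$ be positive integers with $k<n$ and let $p_0,\dots,p_k\in\mathbb{R}^{1,n}$ be in general position. Then $L_{(p_0,\dots,p_k)}$ is $\mathcal{A}$-equivalent to $D_{(p_0,\dots,p_k)}$ if and only if $V(p_0,\dots,p_k)$ is time-like. 2. Let $n$ be a positive integer and let $p_0,\dots,p_n\in\mathbb{R}^{1,n}$ be in general position. Then $L_{(p_0,\dots,p_n)}$ is $\mathcal{A}$-equivalent to $D_{(p_0,\dots,p_n)}$ if and only if $V(p_0,\dots,p_n)$ is time-like or space-like. 3. Let $k,n$ be positive integers with $n<k$ and let $p_0,\dots,p_k\in\mathbb{R}^{1,n}$ be points such that the $n+2$ points $p_0,\dots,p_{n+1}$ are in general position. Then $L_{(p_0,\dots,p_k)}$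 is $\mathcal{A}$-equivalent to $D_{(p_0,\dots,p_k)}$. -/

import Mathlib

open scoped ContDiff Manifold

/-- Real `(n+1)`-space with coordinates `x 0, …, x n`. -/
abbrev RSpace (n : ℕ) : Type := EuclideanSpace ℝ (Fin (n + 1))

/-- The Lorentzian inner product `-x₀y₀ + x₁y₁ + ⋯ + xₙyₙ`. -/
def lorentzInner {n : ℕ} (x y : RSpace n) : ℝ :=
  -(x 0 * y 0) + ∑ i : Fin n, x i.succ * y i.succ

/-- A non-zero vector is time-like if its Lorentzian length is purely imaginary, that is, if
its Lorentzian square is negative. -/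
def IsTimeLikeVector {n : ℕ} (x : RSpace n) : Prop :=
  x ≠ 0 ∧ lorentzInner x x < 0

/-- A non-zero vector is space-like if its Lorentzian length is positive, that is, if
its Lorentzian square is positive. -/
def IsSpaceLikeVector {n : ℕ} (x : RSpace n) : Prop :=
  x ≠ 0 ∧ 0 < lorentzInner x x

/-- A vector subspace is time-like if it has a time-like vector. -/
def IsTimeLike {n : ℕ} (V : Submodule ℝ (RSpace n)) : Prop :=
  ∃ x ∈ V, IsTimeLikeVector x

/-- A vector subspace is space-like if every non-zero vector in it is space-like. -/
def IsSpaceLike {n : ℕ} (V : Submodule ℝ (RSpace n)) : Prop :=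
  ∀ x ∈ V, x ≠ 0 → IsSpaceLikeVector x

/-- The Lorentzian distance-squared function `x ↦ ⟨x - p, x - p⟩`. -/
def lorentzDistSq {n : ℕ} (p x : RSpace n) : ℝ :=
  lorentzInner (x - p) (x - p)

/-- The Lorentzian distance-squared mapping of the points `p 0, …, p k`. -/
def lorentzDistSqMap {n k : ℕ} (p : Fin (k + 1) → RSpace n) (x : RSpace n) : RSpace k :=
  WithLp.toLp 2 fun i => lorentzDistSq (p i) x

/-- The Euclidean distance-squared function `x ↦ (x - p) · (x - p)`. -/
noncomputable def euclidDistSq {n : ℕ} (p x : RSpace n) : ℝ :=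
  inner ℝ (x - p) (x - p)

/-- The (Euclidean) distance-squared mapping of the points `p 0, …, p k`. -/
noncomputable def euclidDistSqMap {n k : ℕ} (p : Fin (k + 1) → RSpace n) (x : RSpace n) :
    RSpace k :=
  WithLp.toLp 2 fun i => euclidDistSq (p i) x

/-- The recognition subspace, spanned by the vectors `p i - p 0` for `i = 1, …, k`. -/
def recognitionSubspace {n k : ℕ} (p : Fin (k + 1) → RSpace n) : Submodule ℝ (RSpace n) :=
  Submodule.span ℝ (Set.range fun i : Fin k => p i.succ - p 0)

/-- The `k + 1` points `p 0, …, p k` are in general position if their recognition subspace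
has dimension `k`. -/
def InGeneralPosition {n k : ℕ} (p : Fin (k + 1) → RSpace n) : Prop :=
  Module.finrank ℝ (recognitionSubspace p) = k

/-- `f` and `g` are `𝒜`-equivalent if `g = H ∘ f ∘ h` for some `C^∞` diffeomorphisms `h` of the
source and `H` of the target. -/
def AEquivalent {n k : ℕ} (f g : RSpace n → RSpace k) : Prop :=
  ∃ (h : Diffeomorph 𝓘(ℝ, RSpace n) 𝓘(ℝ, RSpace n) (RSpace n) (RSpace n) ∞)
    (H : Diffeomorph 𝓘(ℝ, RSpace k) 𝓘(ℝ, RSpace k) (RSpace k) (RSpace k) ∞),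
    g = H ∘ f ∘ h

/-! Write V for the recognition subspace, v_i = p_i - p_0, B for the Lorentzian form, C for the
Euclidean one. Suppose B is nondegenerate on V and definite, of sign ε, on the B-complement of V.
Then some linear h satisfies B(hz, v) = C(z, v) for v in V, so both mappings read off the same
pairings C(z, v_i) from differences of components. What remains, εB(hz, hz) - C(z, z), depends only
on the V-part of z, hence only on these pairings, and a shear of the target removes it
(`aEquivalent_of_nondegenerate_of_pos`). This covers time-like V and space-like hyperplanes.

In the other cases there is a non-zero light-like u orthogonal to V. Then L is constant on the line
p_0 + tu, while fibres of D are bounded (`not_aEquivalent_of_orthogonal_null`). -/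

/-- A positive definite symmetric bilinear form on a real space of dimension `m` is a sum of `m`
squares. -/
theorem equivalent_sum_squares_of_posDef {M : Type*} [AddCommGroup M] [Module ℝ M]
    [FiniteDimensional ℝ M] {m : ℕ} (hm : Module.finrank ℝ M = m) (Q : QuadraticForm ℝ M)
    (hQ : Q.PosDef) :
    QuadraticMap.Equivalent Q (QuadraticMap.weightedSumSquares ℝ fun _ : Fin m => (1 : ℝ)) := by
  subst hm
  obtain ⟨w, hw, ⟨e⟩⟩ := QuadraticForm.equivalent_one_neg_one_weighted_sum_squared Q
    (QuadraticMap.separatingLeft_of_anisotropic Q hQ.anisotropic)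
  have hw1 : w = fun _ => 1 := by
    funext i
    refine (hw i).resolve_left fun hi => ?_
    have hne : e.symm (Pi.single i 1) ≠ 0 := by
      simp
    have h := hQ _ hne
    rw [e.symm.map_app] at h
    simp [QuadraticMap.weightedSumSquares_apply, Pi.single_apply, hi] at h
    linarith
  exact hw1 ▸ ⟨e⟩

/-- Positive definite symmetric bilinear forms on spaces of equal dimension are isometric. -/
theorem exists_linearEquiv_of_pos {M N : Type*} [AddCommGroup M] [Module ℝ M]
    [FiniteDimensional ℝ M] [AddCommGroup N] [Module ℝ N] [FiniteDimensional ℝ N]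
    (h : Module.finrank ℝ M = Module.finrank ℝ N)
    (B : LinearMap.BilinForm ℝ M) (C : LinearMap.BilinForm ℝ N)
    (hB : ∀ x, x ≠ 0 → 0 < B x x) (hC : ∀ x, x ≠ 0 → 0 < C x x) :
    ∃ e : M ≃ₗ[ℝ] N, ∀ x, C (e x) (e x) = B x x := by
  obtain ⟨e⟩ := (equivalent_sum_squares_of_posDef h B.toQuadraticMap fun x hx => hB x hx).trans
    (equivalent_sum_squares_of_posDef rfl C.toQuadraticMap fun x hx => hC x hx).symm
  exact ⟨e.toLinearEquiv, fun x => e.map_app x⟩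

/-- Two symmetric bilinear forms that are nondegenerate on `V` and definite, up to a factor `ε`, on
the orthogonal complements of `V` agree after a linear change of coordinates, up to a factor
on the complement. -/
theorem exists_linearEquiv_of_nondegenerate_of_pos {E : Type*} [AddCommGroup E] [Module ℝ E]
    [FiniteDimensional ℝ E] (V : Submodule ℝ E) {B C : LinearMap.BilinForm ℝ E}
    (hB : B.IsSymm) (hC : C.IsSymm) (hVB : (B.restrict V).Nondegenerate)
    (hVC : (C.restrict V).Nondegenerate) {ε : ℝ}
    (hWB : ∀ w ∈ B.orthogonal V, w ≠ 0 → 0 < ε * B w w)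
    (hWC : ∀ w ∈ C.orthogonal V, w ≠ 0 → 0 < C w w) :
    ∃ (h : E ≃ₗ[ℝ] E) (π : E →ₗ[ℝ] V),
      (∀ x, ∀ v ∈ V, C (π x) v = C x v) ∧ (∀ x, ∀ v ∈ V, B (h x) v = C x v) ∧
      ∀ x, ε * B (h x) (h x) = C x x + (ε * B (h (π x)) (h (π x)) - C (π x) (π x)) := by
  have cB := B.isCompl_orthogonal_of_restrict_nondegenerate hB.isRefl hVB
  have cC := C.isCompl_orthogonal_of_restrict_nondegenerate hC.isRefl hVC
  have hdim : Module.finrank ℝ (C.orthogonal V) = Module.finrank ℝ (B.orthogonal V) := by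
    have h1 := Submodule.finrank_add_eq_of_isCompl cB
    have h2 := Submodule.finrank_add_eq_of_isCompl cC
    omega
  obtain ⟨e, he⟩ := exists_linearEquiv_of_pos hdim (C.restrict (C.orthogonal V))
    (ε • B.restrict (B.orthogonal V))
    (fun w hw => hWC w w.2 (by simpa using hw))
    (fun w hw => by simpa using hWB w w.2 (by simpa using hw))
  -- On V the map need not be an isometry; it only intertwines the two dualities, and the resulting
  -- defect is the last term of the conclusion.
  let f : V ≃ₗ[ℝ] V := (LinearMap.BilinForm.toDual _ hVC).trans
    (LinearMap.BilinForm.toDual _ hVB).symm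
  have hf : ∀ v u : V, B (f v) u = C v u := fun v u =>
    LinearMap.BilinForm.apply_toDual_symm_apply (hB := hVB) (LinearMap.BilinForm.toDual _ hVC v) u
  let iB := Submodule.prodEquivOfIsCompl _ _ cB
  let iC := Submodule.prodEquivOfIsCompl _ _ cC
  let h : E ≃ₗ[ℝ] E := (iC.symm.trans (f.prodCongr e)).trans iB
  have hh : ∀ (v : V) (w : C.orthogonal V), h (v + w) = f v + e w := fun v w => by
    have : iC.symm (v + w) = (v, w) := by
      rw [LinearEquiv.symm_apply_eq]; simp [iC]
    simp [h, this, iB]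
  have hh0 : ∀ v : V, h v = f v := fun v => by simpa using hh v 0
  let π : E →ₗ[ℝ] V := (LinearMap.fst ℝ V _).comp iC.symm.toLinearMap
  have key : ∀ x, ∃ w : C.orthogonal V, x = π x + w := fun x =>
    ⟨(iC.symm x).2, by
      conv_lhs => rw [← iC.apply_symm_apply x]
      simp [iC, π, -LinearEquiv.apply_symm_apply]⟩
  have oB : ∀ v ∈ V, ∀ w ∈ B.orthogonal V, B v w = 0 ∧ B w v = 0 := fun v hv w hw =>
    ⟨hw v hv, by rw [hB.eq]; exact hw v hv⟩
  have oC : ∀ v ∈ V, ∀ w ∈ C.orthogonal V, C v w = 0 ∧ C w v = 0 := fun v hv w hw =>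
    ⟨hw v hv, by rw [hC.eq]; exact hw v hv⟩
  refine ⟨h, π, fun x v hv => ?_, fun x v hv => ?_, fun x => ?_⟩
  · obtain ⟨w, hw⟩ := key x
    conv_rhs => rw [hw]
    simp [(oC v hv w w.2).2]
  · obtain ⟨w, hw⟩ := key x
    rw [hw, hh]
    simpa [(oC v hv w w.2).2, (oB v hv (e w) (e w).2).2] using hf (π x) ⟨v, hv⟩
  · obtain ⟨w, hw⟩ := key x
    have he' : ε * B (e w) (e w) = C w w := by simpa using he w
    have e1 : B (h x) (h x) = B (f (π x)) (f (π x)) + B (e w) (e w) := by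
      conv_lhs => rw [hw, hh]
      simp [(oB (f (π x)) (f (π x)).2 (e w) (e w).2).1, (oB (f (π x)) (f (π x)).2 (e w) (e w).2).2]
    have e2 : C x x = C (π x) (π x) + C w w := by
      conv_lhs => rw [hw]
      simp [(oC (π x) (π x).2 w w.2).1, (oC (π x) (π x).2 w w.2).2]
    rw [e1, e2, hh0, ← he']
    ring

theorem LinearMap.BilinForm.contDiff_apply_self {E F : Type*} [NormedAddCommGroup E]
    [NormedSpace ℝ E] [FiniteDimensional ℝ E] [AddCommGroup F] [Module ℝ F]
    (B : LinearMap.BilinForm ℝ F) (l : E →ₗ[ℝ] F) {m : WithTop ℕ∞} :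
    ContDiff ℝ m fun x => B (l x) (l x) := by
  have h : ContDiff ℝ m fun x => (B.compl₁₂ l l).toContinuousBilinearMap x x :=
    (ContinuousLinearMap.contDiff _).clm_apply contDiff_id
  exact h

/-! ### Shear of the target and the equivalence criterion -/

/-- The change of coordinates of the target space that relates the distance-squared mappings of
two symmetric bilinear forms. -/
theorem exists_diffeomorph_shear {k : ℕ} {ε : ℝ} (hε : ε ≠ 0) (b c : Fin (k + 1) → ℝ)
    (hb : b 0 = 0) (hc : c 0 = 0) {q : (Fin (k + 1) → ℝ) → ℝ} (hq : ContDiff ℝ ∞ q) :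
    ∃ H : Diffeomorph 𝓘(ℝ, RSpace k) 𝓘(ℝ, RSpace k) (RSpace k) (RSpace k) ∞,
      ∀ y i, H y i = ε * y 0 - q (fun j => (y 0 - y j + b j) / 2) - (y 0 - y i + b i) + c i := by
  let F : RSpace k → RSpace k := fun y => WithLp.toLp 2 fun i =>
    ε * y 0 - q (fun j => (y 0 - y j + b j) / 2) - (y 0 - y i + b i) + c i
  -- `F` carries y_0 - y_j + b_j to y_0 - y_j + c_j because b_0 = c_0 = 0, so `q` gets the same
  -- argument both ways and its contribution can be undone.
  let G : RSpace k → RSpace k := fun y => WithLp.toLp 2 fun i =>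
    ε⁻¹ * (y 0 + q (fun j => (y 0 - y j + c j) / 2)) - (y 0 - y i + c i) + b i
  have coord : ∀ i, ContDiff ℝ ∞ fun y : RSpace k => y i := fun i =>
    contDiff_euclidean.1 contDiff_id i
  have hd : ∀ a : Fin (k + 1) → ℝ,
      ContDiff ℝ ∞ fun y : RSpace k => q fun j => (y 0 - y j + a j) / 2 := fun a =>
    hq.comp (contDiff_pi.2 fun j =>
      (((coord 0).sub (coord j)).add contDiff_const).div_const _)
  have hF : ContDiff ℝ ∞ F := contDiff_euclidean.2 fun i =>
    (((contDiff_const.mul (coord 0)).sub (hd b)).sub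
      (((coord 0).sub (coord i)).add contDiff_const)).add contDiff_const
  have hG : ContDiff ℝ ∞ G := contDiff_euclidean.2 fun i =>
    ((contDiff_const.mul ((coord 0).add (hd c))).sub
      (((coord 0).sub (coord i)).add contDiff_const)).add contDiff_const
  refine ⟨⟨⟨F, G, fun y => ?_, fun y => ?_⟩, hF.contMDiff, hG.contMDiff⟩, fun y i => rfl⟩
  · have e : ∀ j, F y 0 - F y j + c j = y 0 - y j + b j := fun j => by
      simp [F, hb, hc]; ring
    have e0 : F y 0 = ε * y 0 - q (fun j => (y 0 - y j + b j) / 2) := by simp [F, hb, hc]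
    ext i
    change ε⁻¹ * (F y 0 + q (fun j => (F y 0 - F y j + c j) / 2)) - (F y 0 - F y i + c i) + b i = _
    simp only [e]
    rw [e0]
    field_simp
    ring
  · have e : ∀ j, G y 0 - G y j + b j = y 0 - y j + c j := fun j => by
      simp [G, hb, hc]; ring
    have e0 : G y 0 = ε⁻¹ * (y 0 + q (fun j => (y 0 - y j + c j) / 2)) := by simp [G, hb, hc]
    ext i
    change ε * G y 0 - q (fun j => (G y 0 - G y j + b j) / 2) - (G y 0 - G y i + b i) + c i = _
    simp only [e]
    rw [e0]
    field_simp
    ring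

/-- Criterion for the `𝒜`-equivalence of the distance-squared mappings of two symmetric bilinear
forms. -/
theorem aEquivalent_of_nondegenerate_of_pos {n k : ℕ} (p : Fin (k + 1) → RSpace n)
    {B C : LinearMap.BilinForm ℝ (RSpace n)} (hB : B.IsSymm) (hC : C.IsSymm)
    (hVB : (B.restrict (recognitionSubspace p)).Nondegenerate)
    (hVC : (C.restrict (recognitionSubspace p)).Nondegenerate) {ε : ℝ} (hε : ε ≠ 0)
    (hWB : ∀ w ∈ B.orthogonal (recognitionSubspace p), w ≠ 0 → 0 < ε * B w w)
    (hWC : ∀ w ∈ C.orthogonal (recognitionSubspace p), w ≠ 0 → 0 < C w w) :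
    AEquivalent (k := k) (fun x => WithLp.toLp 2 fun i => B (x - p i) (x - p i))
      (fun x => WithLp.toLp 2 fun i => C (x - p i) (x - p i)) := by
  obtain ⟨h, π, hπ, hBC, hQ⟩ := exists_linearEquiv_of_nondegenerate_of_pos
    (recognitionSubspace p) hB hC hVB hVC hWB hWC
  have hv : ∀ i, p i - p 0 ∈ recognitionSubspace p := fun i => by
    refine Fin.cases ?_ (fun j => ?_) i
    · simp
    · exact Submodule.subset_span ⟨j, rfl⟩
  let Δ : RSpace n →ₗ[ℝ] (Fin (k + 1) → ℝ) := LinearMap.pi fun i => C.flip (p i - p 0)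
  -- The v_i span V and C is nondegenerate there, so the pairings determine the V-part; `s` recovers
  -- it linearly.
  have hΔ : LinearMap.ker (Δ.comp (recognitionSubspace p).subtype) = ⊥ := by
    rw [LinearMap.ker_eq_bot']
    intro v hv0
    refine hVC.1 v fun u => ?_
    change C v u = 0
    obtain ⟨u, hu⟩ := u
    induction hu using Submodule.span_induction with
    | mem x hx =>
      obtain ⟨j, rfl⟩ := hx
      exact congrFun hv0 j.succ
    | zero => simp
    | add x y _ _ hx hy => simp_all
    | smul a x _ hx => simp_all
  obtain ⟨s, hs⟩ := LinearMap.exists_leftInverse_of_injective _ hΔ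
  have hsπ : ∀ x, s (Δ x) = π x := fun x => by
    have e : Δ x = Δ (π x) := by
      funext i
      exact (hπ x _ (hv i)).symm
    rw [e]
    exact LinearMap.congr_fun hs (π x)
  let q : (Fin (k + 1) → ℝ) → ℝ := fun d => ε * B (h (s d)) (h (s d)) - C (s d) (s d)
  have hq : ContDiff ℝ ∞ q :=
    (contDiff_const.mul (B.contDiff_apply_self
      (h.toLinearMap.comp ((recognitionSubspace p).subtype.comp s)))).sub
      (C.contDiff_apply_self ((recognitionSubspace p).subtype.comp s))
  obtain ⟨H, hH⟩ := exists_diffeomorph_shear hε (fun i => B (p i - p 0) (p i - p 0))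
    (fun i => C (p i - p 0) (p i - p 0)) (by simp) (by simp) hq
  have expand : ∀ {D : LinearMap.BilinForm ℝ (RSpace n)}, D.IsSymm → ∀ z v,
      D (z - v) (z - v) = D z z - 2 * D z v + D v v := fun hD z v => by
    simp [hD.eq v z]
    ring
  have hcont : ∀ g : RSpace n ≃ₗ[ℝ] RSpace n,
      ContMDiff 𝓘(ℝ, RSpace n) 𝓘(ℝ, RSpace n) ∞ fun x => p 0 + g (x - p 0) := fun g =>
    (contDiff_const.add (g.toContinuousLinearEquiv.contDiff.comp
      (contDiff_id.sub contDiff_const))).contMDiff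
  let T : Diffeomorph 𝓘(ℝ, RSpace n) 𝓘(ℝ, RSpace n) (RSpace n) (RSpace n) ∞ :=
    ⟨⟨fun x => p 0 + h (x - p 0), fun x => p 0 + h.symm (x - p 0),
      fun x => by simp, fun x => by simp⟩, hcont h, hcont h.symm⟩
  refine ⟨T, H, ?_⟩
  funext x
  ext i
  simp only [Function.comp_apply, hH]
  set z := x - p 0 with hz
  have hT : ∀ j, T x - p j = h z - (p j - p 0) := fun j => by
    change p 0 + h z - p j = _
    abel
  have hx : ∀ j, x - p j = z - (p j - p 0) := fun j => by rw [hz]; abel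
  have hd : ∀ j, B (h z) (h z) - B (h z - (p j - p 0)) (h z - (p j - p 0))
      + B (p j - p 0) (p j - p 0) = 2 * C z (p j - p 0) := fun j => by
    rw [expand hB, hBC z _ (hv j)]
    ring
  have hqz : q (fun j => C z (p j - p 0)) = ε * B (h z) (h z) - C z z := by
    have e : q (Δ z) = ε * B (h z) (h z) - C z z := by
      simp only [q, hsπ]
      linarith [hQ z]
    exact e
  have h0 : T x - p 0 = h z := by simpa using hT 0
  rw [h0]
  simp only [hT, hd, hx]
  rw [expand hC]
  simp only [mul_div_cancel_left₀ _ (two_ne_zero' ℝ), hqz]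
  ring

/-! ### Obstruction from unbounded fibres -/

/-- A mapping that is constant along a line has no `𝒜`-equivalent mapping with bounded fibres. -/
theorem not_aEquivalent_of_constant_on_line {n k : ℕ} {f g : RSpace n → RSpace k}
    {a u : RSpace n} (hu : u ≠ 0) (hf : ∀ t : ℝ, f (a + t • u) = f a)
    (hg : ∀ y, Bornology.IsBounded (g ⁻¹' {y})) : ¬ AEquivalent f g := by
  rintro ⟨h, H, rfl⟩
  have hK : IsCompact (closure ((H ∘ f ∘ h) ⁻¹' {H (f a)})) :=
    (hg (H (f a))).isCompact_closure
  have hb := (hK.image h.continuous).isBounded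
  obtain ⟨R, hR⟩ := hb.exists_norm_le
  have hline : ∀ t : ℝ, ‖a + t • u‖ ≤ R := fun t => by
    refine hR _ ⟨h.symm (a + t • u), subset_closure ?_, h.apply_symm_apply _⟩
    simp [hf]
  have hu' : 0 < ‖u‖ := norm_pos_iff.2 hu
  -- This parameter gives t • u the norm |R + ‖a‖ + 1|, too long for a + t • u to stay in the ball
  -- of radius R.
  have h1 := hline ((R + ‖a‖ + 1) / ‖u‖)
  have h2 : ‖((R + ‖a‖ + 1) / ‖u‖) • u‖ = |R + ‖a‖ + 1| := by
    rw [norm_smul, norm_div, norm_norm, div_mul_cancel₀ _ hu'.ne', Real.norm_eq_abs]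
  have h3 := norm_sub_norm_le (((R + ‖a‖ + 1) / ‖u‖) • u) (-a)
  rw [sub_neg_eq_add, norm_neg, add_comm _ a, h2] at h3
  linarith [le_abs_self (R + ‖a‖ + 1)]

theorem isBounded_euclidDistSqMap_fibre {n k : ℕ} (p : Fin (k + 1) → RSpace n) (y : RSpace k) :
    Bornology.IsBounded (euclidDistSqMap p ⁻¹' {y}) := by
  refine (Metric.isBounded_closedBall (x := p 0) (r := √(y 0))).subset fun x hx => ?_
  have h : inner ℝ (x - p 0) (x - p 0) = y 0 := congrArg (fun z : RSpace k => z 0) hx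
  rw [Metric.mem_closedBall, dist_eq_norm, ← h, real_inner_self_eq_norm_sq,
    Real.sqrt_sq (norm_nonneg _)]

/-! ### Lorentzian linear algebra -/

/-- The Lorentzian inner product as a bilinear form. -/
def lorentzForm (n : ℕ) : LinearMap.BilinForm ℝ (RSpace n) :=
  LinearMap.mk₂ ℝ lorentzInner
    (fun x y z => by
      simp only [lorentzInner, PiLp.add_apply, add_mul, Finset.sum_add_distrib]; ring)
    (fun a x y => by
      simp only [lorentzInner, PiLp.smul_apply, smul_eq_mul, mul_assoc, ← Finset.mul_sum]; ring)
    (fun x y z => by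
      simp only [lorentzInner, PiLp.add_apply, mul_add, Finset.sum_add_distrib]; ring)
    (fun a x y => by
      simp only [lorentzInner, PiLp.smul_apply, smul_eq_mul, mul_left_comm _ a, ← Finset.mul_sum]
      ring)

theorem lorentzForm_apply {n : ℕ} (x y : RSpace n) : lorentzForm n x y = lorentzInner x y := rfl

theorem lorentzForm_isSymm (n : ℕ) : (lorentzForm n).IsSymm :=
  ⟨fun x y => by simp [lorentzForm_apply, lorentzInner, mul_comm]⟩

/-- A non-zero vector orthogonal to a time-like vector is space-like. -/
theorem lorentzForm_pos_of_orthogonal {n : ℕ} {x z : RSpace n} (hx : lorentzForm n x x < 0)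
    (hxz : lorentzForm n x z = 0) (hz : z ≠ 0) : 0 < lorentzForm n z z := by
  simp only [lorentzForm_apply, lorentzInner] at *
  -- Cauchy–Schwarz on the spatial parts gives (x₀z₀)² ≤ XZ, while X < x₀²; so z₀² < Z unless Z = 0,
  -- which forces z = 0.
  have hcs := Finset.sum_mul_sq_le_sq_mul_sq Finset.univ (fun i : Fin n => x i.succ)
    (fun i => z i.succ)
  simp only [← sq] at *
  set X := ∑ i : Fin n, x i.succ ^ 2
  set Z := ∑ i : Fin n, z i.succ ^ 2 with hZ
  have hZ0 : 0 ≤ Z := Finset.sum_nonneg fun i _ => sq_nonneg _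
  have hX0 : 0 ≤ X := Finset.sum_nonneg fun i _ => sq_nonneg _
  have hsum : ∑ i : Fin n, x i.succ * z i.succ = x 0 * z 0 := by linarith
  rw [hsum] at hcs
  rcases hZ0.eq_or_lt with h | h
  · exfalso
    rw [← h, mul_zero] at hcs
    have hx0 : x 0 ≠ 0 := fun h0 => by rw [h0] at hx; linarith
    have hz0 : z 0 = 0 := by
      have := pow_eq_zero_iff (two_ne_zero) |>.1 (le_antisymm hcs (sq_nonneg _))
      exact (mul_eq_zero.1 this).resolve_left hx0
    refine hz ?_
    ext i
    refine Fin.cases hz0 (fun j => ?_) i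
    have := (Finset.sum_eq_zero_iff_of_nonneg fun i _ => sq_nonneg (z (Fin.succ i))).1
      (hZ.symm.trans h.symm) j (Finset.mem_univ j)
    simpa using this
  · have h1 : X * Z < x 0 ^ 2 * Z := by nlinarith
    have h2 : x 0 ^ 2 * z 0 ^ 2 < x 0 ^ 2 * Z := by nlinarith
    have := lt_of_mul_lt_mul_left h2 (sq_nonneg _)
    linarith

theorem LinearMap.BilinForm.restrict_nondegenerate_of_forall {E : Type*} [AddCommGroup E]
    [Module ℝ E] {B : LinearMap.BilinForm ℝ E} (hB : B.IsSymm) (V : Submodule ℝ E)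
    (h : ∀ v ∈ V, (∀ u ∈ V, B v u = 0) → v = 0) : (B.restrict V).Nondegenerate := by
  have hl : ∀ v : V, (∀ u : V, B v u = 0) → v = 0 := fun v hv =>
    Subtype.ext (h v v.2 fun u hu => hv ⟨u, hu⟩)
  exact ⟨hl, fun v hv => hl v fun u => by rw [hB.eq]; exact hv u⟩

/-- A non-zero radical vector would be orthogonal to a time-like vector, hence space-like, yet
orthogonal to itself. -/
theorem IsTimeLike.restrict_nondegenerate {n : ℕ} {V : Submodule ℝ (RSpace n)}
    (hV : IsTimeLike V) : ((lorentzForm n).restrict V).Nondegenerate := by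
  obtain ⟨x, hxV, -, hx⟩ := hV
  refine LinearMap.BilinForm.restrict_nondegenerate_of_forall (lorentzForm_isSymm n) V
    fun v hv h => ?_
  by_contra hv0
  have := lorentzForm_pos_of_orthogonal hx ((lorentzForm_isSymm n).eq v x ▸ h x hxV) hv0
  exact this.ne' (h v hv)

theorem IsSpaceLike.restrict_nondegenerate {n : ℕ} {V : Submodule ℝ (RSpace n)}
    (hV : IsSpaceLike V) : ((lorentzForm n).restrict V).Nondegenerate := by
  refine LinearMap.BilinForm.restrict_nondegenerate_of_forall (lorentzForm_isSymm n) V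
    fun v hv h => ?_
  by_contra hv0
  exact (hV v hv hv0).2.ne' (h v hv)

theorem IsTimeLike.top (n : ℕ) : IsTimeLike (⊤ : Submodule ℝ (RSpace n)) :=
  ⟨EuclideanSpace.single 0 1, trivial, by simp, by simp [lorentzInner]⟩

/-- The orthogonal complement of a space-like subspace has a time-like vector. -/
theorem IsSpaceLike.exists_orthogonal_neg {n : ℕ} {V : Submodule ℝ (RSpace n)}
    (hV : IsSpaceLike V) : ∃ w ∈ (lorentzForm n).orthogonal V, lorentzForm n w w < 0 := by
  have hc := (lorentzForm n).isCompl_orthogonal_of_restrict_nondegenerate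
    (lorentzForm_isSymm n).isRefl hV.restrict_nondegenerate
  obtain ⟨x, -, -, hx⟩ := IsTimeLike.top n
  obtain ⟨v, hv, w, hw, rfl⟩ := Submodule.mem_sup.1 (hc.sup_eq_top ▸ Submodule.mem_top (x := x))
  refine ⟨w, hw, ?_⟩
  have hvw : lorentzForm n v w = 0 := hw v hv
  have hwv : lorentzForm n w v = 0 := (lorentzForm_isSymm n).eq v w ▸ hvw
  have hvv : 0 ≤ lorentzForm n v v := by
    by_cases h : v = 0
    · simp [h]
    · exact (hV v hv h).2.le
  rw [← lorentzForm_apply] at hx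
  simp only [map_add, LinearMap.add_apply, hvw, hwv] at hx
  linarith

/-- The orthogonal complement of a space-like subspace of codimension at least two has a
non-zero light-like vector. -/
theorem IsSpaceLike.exists_orthogonal_null {n : ℕ} {V : Submodule ℝ (RSpace n)}
    (hV : IsSpaceLike V) (hdim : Module.finrank ℝ V < n) :
    ∃ u ∈ (lorentzForm n).orthogonal V, u ≠ 0 ∧ lorentzForm n u u = 0 := by
  obtain ⟨w, hw, hneg⟩ := hV.exists_orthogonal_neg
  have hc := (lorentzForm n).isCompl_orthogonal_of_restrict_nondegenerate
    (lorentzForm_isSymm n).isRefl hV.restrict_nondegenerate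
  have hfin := Submodule.finrank_add_eq_of_isCompl hc
  have hsp : Module.finrank ℝ (RSpace n) = n + 1 := finrank_euclideanSpace_fin
  let φ : (lorentzForm n).orthogonal V →ₗ[ℝ] ℝ := (lorentzForm n w).comp (Submodule.subtype _)
  -- The complement has dimension at least 2, leaving room for a space-like z orthogonal to w; w +
  -- tz is light-like for a suitable t.
  obtain ⟨⟨z, hz⟩, hzφ, hz0⟩ := (LinearMap.ker φ).exists_mem_ne_zero_of_ne_bot
    (LinearMap.ker_ne_bot_of_finrank_lt (by rw [Module.finrank_self]; omega))
  have hwz : lorentzForm n w z = 0 := hzφ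
  have hzw : lorentzForm n z w = 0 := (lorentzForm_isSymm n).eq w z ▸ hwz
  have hpos := lorentzForm_pos_of_orthogonal hneg hwz (by simpa using hz0)
  set t := √(-lorentzForm n w w / lorentzForm n z z)
  have ht : t * t * lorentzForm n z z = -lorentzForm n w w := by
    rw [Real.mul_self_sqrt (div_nonneg (by linarith) hpos.le), div_mul_cancel₀ _ hpos.ne']
  refine ⟨w + t • z, add_mem hw (Submodule.smul_mem _ t hz), fun h0 => ?_, ?_⟩
  · have := congrArg (lorentzForm n w) h0
    simp [hwz] at this
    linarith
  · simp only [map_add, map_smul, LinearMap.add_apply, LinearMap.smul_apply, smul_eq_mul, hwz, hzw]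
    linarith

/-- A subspace that is neither time-like nor space-like contains a non-zero light-like vector orthogonal
to it. -/
theorem exists_orthogonal_null_of_not_timeLike {n : ℕ} {V : Submodule ℝ (RSpace n)}
    (ht : ¬ IsTimeLike V) (hs : ¬ IsSpaceLike V) :
    ∃ u ∈ (lorentzForm n).orthogonal V, u ≠ 0 ∧ lorentzForm n u u = 0 := by
  have hnn : ∀ v ∈ V, 0 ≤ lorentzForm n v v := fun v hv => by
    by_contra! h
    exact ht ⟨v, hv, by rintro rfl; simp at h, h⟩
  simp only [IsSpaceLike, IsSpaceLikeVector, not_forall] at hs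
  obtain ⟨u, huV, hu0, hu⟩ := hs
  have huu : lorentzForm n u u = 0 :=
    le_antisymm (not_lt.1 fun h => hu ⟨hu0, h⟩) (hnn u huV)
  refine ⟨u, fun v hv => ?_, hu0, huu⟩
  change lorentzForm n v u = 0
  have huv : lorentzForm n u v = lorentzForm n v u := (lorentzForm_isSymm n).eq u v
  -- Since u is light-like, the square of v + tu is affine in t; being nonnegative, it has zero
  -- slope.
  have h : ∀ t : ℝ, 0 ≤ 2 * t * lorentzForm n v u + lorentzForm n v v := fun t => by
    have := hnn _ (add_mem hv (Submodule.smul_mem _ t huV))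
    simp only [map_add, map_smul, LinearMap.add_apply, LinearMap.smul_apply, smul_eq_mul, huu,
      huv] at this
    linarith
  by_contra hne
  -- Here the affine function takes the value -1.
  have := h (-(lorentzForm n v v + 1) / (2 * lorentzForm n v u))
  field_simp at this
  linarith

/-! ### Lorentzian versus Euclidean mappings -/

theorem euclidForm_isSymm (n : ℕ) : LinearMap.BilinForm.IsSymm (innerₗ (RSpace n)) :=
  ⟨fun x y => real_inner_comm y x⟩

theorem aEquivalent_of_lorentz_definite {n k : ℕ} (p : Fin (k + 1) → RSpace n)
    (hV : ((lorentzForm n).restrict (recognitionSubspace p)).Nondegenerate) {ε : ℝ} (hε : ε ≠ 0)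
    (hW : ∀ w ∈ (lorentzForm n).orthogonal (recognitionSubspace p), w ≠ 0 →
      0 < ε * lorentzForm n w w) :
    AEquivalent (lorentzDistSqMap p) (euclidDistSqMap p) :=
  aEquivalent_of_nondegenerate_of_pos p (lorentzForm_isSymm n) (euclidForm_isSymm n) hV
    (LinearMap.BilinForm.restrict_nondegenerate_of_forall (euclidForm_isSymm n) _
      fun v hv h => inner_self_eq_zero.1 (h v hv)) hε hW
    fun _ _ hw => real_inner_self_pos.2 hw

theorem IsTimeLike.aEquivalent {n k : ℕ} {p : Fin (k + 1) → RSpace n}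
    (hV : IsTimeLike (recognitionSubspace p)) :
    AEquivalent (lorentzDistSqMap p) (euclidDistSqMap p) := by
  refine aEquivalent_of_lorentz_definite p hV.restrict_nondegenerate one_ne_zero
    fun w hw hw0 => ?_
  obtain ⟨x, hxV, -, hx⟩ := hV
  simpa using lorentzForm_pos_of_orthogonal hx (hw x hxV) hw0

theorem IsSpaceLike.aEquivalent {n k : ℕ} {p : Fin (k + 1) → RSpace n}
    (hV : IsSpaceLike (recognitionSubspace p))
    (hdim : Module.finrank ℝ (recognitionSubspace p) = n) :
    AEquivalent (lorentzDistSqMap p) (euclidDistSqMap p) := by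
  refine aEquivalent_of_lorentz_definite p hV.restrict_nondegenerate (ε := -1) (by norm_num)
    fun w hw hw0 => ?_
  obtain ⟨z, hz, hneg⟩ := hV.exists_orthogonal_neg
  have hfin := Submodule.finrank_add_eq_of_isCompl
    ((lorentzForm n).isCompl_orthogonal_of_restrict_nondegenerate
      (lorentzForm_isSymm n).isRefl hV.restrict_nondegenerate)
  have hsp : Module.finrank ℝ (RSpace n) = n + 1 := finrank_euclideanSpace_fin
  -- The complement is a line containing a time-like vector, so the form is negative on it; hence ε
  -- = -1.
  have h1 : Module.finrank ℝ ((lorentzForm n).orthogonal (recognitionSubspace p)) = 1 := by omega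
  obtain ⟨c, hc⟩ := (finrank_eq_one_iff_of_nonzero' (⟨w, hw⟩ : (lorentzForm n).orthogonal _)
    (by simpa using hw0)).1 h1 ⟨z, hz⟩
  have hcz : z = c • w := (congrArg Subtype.val hc).symm
  rw [hcz] at hneg
  simp only [map_smul, LinearMap.smul_apply, smul_eq_mul] at hneg
  by_contra! hcon
  nlinarith [mul_nonneg (mul_self_nonneg c) (by linarith : 0 ≤ lorentzForm n w w)]

theorem not_aEquivalent_of_orthogonal_null {n k : ℕ} {p : Fin (k + 1) → RSpace n}
    (h : ∃ u ∈ (lorentzForm n).orthogonal (recognitionSubspace p),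
      u ≠ 0 ∧ lorentzForm n u u = 0) :
    ¬ AEquivalent (lorentzDistSqMap p) (euclidDistSqMap p) := by
  obtain ⟨u, hu, hu0, huu⟩ := h
  refine not_aEquivalent_of_constant_on_line (a := p 0) hu0 (fun t => ?_)
    (isBounded_euclidDistSqMap_fibre p)
  ext i
  have hi : p i - p 0 ∈ recognitionSubspace p := by
    refine Fin.cases ?_ (fun j => ?_) i
    · simp
    · exact Submodule.subset_span ⟨j, rfl⟩
  change lorentzForm n (p 0 + t • u - p i) (p 0 + t • u - p i)
    = lorentzForm n (p 0 - p i) (p 0 - p i)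
  have e1 : p 0 + t • u - p i = t • u - (p i - p 0) := by abel
  rw [e1, ← neg_sub (p i)]
  generalize p i - p 0 = v at hi ⊢
  have h1 : lorentzForm n v u = 0 := hu v hi
  have h2 : lorentzForm n u v = 0 := (lorentzForm_isSymm n).eq v u ▸ h1
  simp [huu, h1, h2]

theorem corollary2 :
    (∀ (k n : ℕ), 0 < k → k < n → ∀ p : Fin (k + 1) → RSpace n, InGeneralPosition p →
      (AEquivalent (lorentzDistSqMap p) (euclidDistSqMap p) ↔
        IsTimeLike (recognitionSubspace p))) ∧
    (∀ (n : ℕ), 0 < n → ∀ p : Fin (n + 1) → RSpace n, InGeneralPosition p →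
      (AEquivalent (lorentzDistSqMap p) (euclidDistSqMap p) ↔
        (IsTimeLike (recognitionSubspace p) ∨ IsSpaceLike (recognitionSubspace p)))) ∧
    (∀ (k n : ℕ) (_hn : 0 < n) (hnk : n < k), ∀ p : Fin (k + 1) → RSpace n,
      InGeneralPosition (fun i : Fin (n + 1 + 1) =>
        p (Fin.castLE (Nat.succ_le_succ (Nat.succ_le_of_lt hnk)) i)) →
      AEquivalent (lorentzDistSqMap p) (euclidDistSqMap p)) := by
  refine ⟨fun k n _ hkn p hp => ⟨fun h => ?_, IsTimeLike.aEquivalent⟩,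
    fun n _ p hp => ⟨fun h => ?_, fun h => h.elim IsTimeLike.aEquivalent (·.aEquivalent hp)⟩,
    fun k n _ hnk p hp => ?_⟩
  · by_contra ht
    refine not_aEquivalent_of_orthogonal_null ?_ h
    by_cases hs : IsSpaceLike (recognitionSubspace p)
    · exact hs.exists_orthogonal_null (hp.trans_lt hkn)
    · exact exists_orthogonal_null_of_not_timeLike ht hs
  · by_contra! hc
    exact not_aEquivalent_of_orthogonal_null
      (exists_orthogonal_null_of_not_timeLike hc.1 hc.2) h
  · refine IsTimeLike.aEquivalent ?_
    have hle : recognitionSubspace (fun i : Fin (n + 1 + 1) =>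
        p (Fin.castLE (Nat.succ_le_succ (Nat.succ_le_of_lt hnk)) i)) ≤ recognitionSubspace p := by
      refine Submodule.span_mono ?_
      rintro _ ⟨j, rfl⟩
      exact ⟨Fin.castLE hnk j, rfl⟩
    -- The first n + 2 points already span the whole space, which contains the time axis.
    have htop := Submodule.eq_top_of_finrank_eq (hp.trans finrank_euclideanSpace_fin.symm)
    have htop' : recognitionSubspace p = ⊤ := top_le_iff.1 (htop.ge.trans hle)
    exact htop' ▸ IsTimeLike.top n
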